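/- Let $G$ be a Hausdorff topological group with identity $e$. A group $\Gamma$ of topological automorphisms of $G$ acts distally on $G$ if for every $x\in G\setminus\{e\}$ the identity $e$ is not in the closure of the orbit $\{\gamma(x):\gamma\in\Gamma\}$. The group $G$ is distal if the group $\operatorname{Inn}(G)$ of its inner automorphisms acts distally on $G$; an element $g\in G$ is distal if the cyclic group generated by the inner automorphism $x\mapsto gxg^{-1}$ acts distally on $G$. A topological group is SIN if its identity has a neighbourhood base consisting of neighbourhoods invariant under all inner automorphisms. **Theorem 2.7.** Suppose that a totally disconnected metrizable locally compact group $G$ admits an open normal subgroup $N$ which is SIN (as a topological group with the subspace topology) and such that the quotient $G/N$ contains a polycyclic subgroup of finite index. Then the following conditions are equivalent: (i) $G$ is distal; (ii) every $g\in G$ is distal; (iii) $G$ is SIN. -/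

import Mathlib

open Topology

/-- The group `Inn(G)` of inner automorphisms `x ↦ g * x * g⁻¹` of `G`, as a subgroup of the
automorphism group. (When `G` is a topological group, these are all topological automorphisms.) -/
def innerAut (G : Type*) [Group G] : Subgroup (MulAut G) :=
  (MulAut.conj : G →* MulAut G).range

/-- A group `Γ` of automorphisms of a topological group `G` acts distally on `G` if for every
`x ≠ 1` the identity element is not in the closure of the orbit `Γ x`. -/
def ActsDistally {G : Type*} [Group G] [TopologicalSpace G] (Γ : Subgroup (MulAut G)) : Prop :=
  ∀ x : G, x ≠ 1 → (1 : G) ∉ closure {y : G | ∃ γ ∈ Γ, γ x = y}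

/-- A single automorphism is distal if the subgroup it generates acts distally. -/
def IsDistalAut {G : Type*} [Group G] [TopologicalSpace G] (γ : MulAut G) : Prop :=
  ActsDistally (Subgroup.zpowers γ)

/-- An element `g` is distal if the inner automorphism `x ↦ g * x * g⁻¹` is distal. -/
def IsDistalElement {G : Type*} [Group G] [TopologicalSpace G] (g : G) : Prop :=
  IsDistalAut (MulAut.conj g)

/-- A topological group is distal if its group of inner automorphisms acts distally on it. -/
def IsDistalGroup (G : Type*) [Group G] [TopologicalSpace G] : Prop :=
  ActsDistally (innerAut G)

/-- A group `Γ` of automorphisms is equicontinuous (at the identity) if there is a neighbourhood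
base at the identity consisting of neighbourhoods that are invariant under `Γ`. -/
def IsEquicontinuousAutGroup {G : Type*} [Group G] [TopologicalSpace G]
    (Γ : Subgroup (MulAut G)) : Prop :=
  (𝓝 (1 : G)).HasBasis (fun V : Set G => V ∈ 𝓝 (1 : G) ∧ ∀ γ ∈ Γ, γ '' V = V) id

/-- A SIN group (small invariant neighbourhoods): a topological group whose group of inner
automorphisms is equicontinuous. -/
def IsSIN (G : Type*) [Group G] [TopologicalSpace G] : Prop :=
  IsEquicontinuousAutGroup (innerAut G)

/-- A group is polycyclic if it has a finite series `1 = H₀ ≤ H₁ ≤ ⋯ ≤ Hₙ = G` of subgroups such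
that each `Hᵢ` is normal in `Hᵢ₊₁` with cyclic quotient `Hᵢ₊₁ / Hᵢ`. -/
def IsPolycyclic (G : Type*) [Group G] : Prop :=
  ∃ (n : ℕ) (H : ℕ → Subgroup G), H 0 = ⊥ ∧ H n = ⊤ ∧
    ∀ i < n, H i ≤ H (i + 1) ∧
      ∃ _ : ((H i).subgroupOf (H (i + 1))).Normal,
        IsCyclic (H (i + 1) ⧸ (H i).subgroupOf (H (i + 1)))

/-- A group is virtually polycyclic if it contains a polycyclic subgroup of finite index. -/
def IsVirtuallyPolycyclic (G : Type*) [Group G] : Prop :=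
  ∃ P : Subgroup G, P.FiniteIndex ∧ IsPolycyclic P

/-!
The substance is the implication from "every element is distal" to "`G` is SIN". It rests on a
zero-dimensional rigidity phenomenon for a single automorphism `α`: if `α` is distal and `V` is
compact and open, then `⋂ k : ℤ, α ^ k V` is still open (`isOpen_setOf_forall_zpow_apply_mem`).

To see this, take the limit `y` of `α ^ n x` along an idempotent ultrafilter of positive integers,
where the forward orbit of `x` stays in a compact set. Idempotence makes `α ^ n x` and `α ^ n y`
proximal, so distality gives `x = y`: the point `x` is recurrent
(`IsDistalAut.exists_pos_pow_apply_mem`). Hence the closed set of points whose forward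
orbit stays in `V` is mapped onto itself by `α`, that is, a point staying in `V` for all positive
times has stayed in `V` for all negative times (`IsDistalAut.zpow_apply_mem`). If
`⋂ k, α ^ k V` were not open, there would be orbit segments of arbitrary length that stay in `V` and
then leave it; a cluster point of their last points in `V` contradicts this (for `α⁻¹`).

For the theorem, consider subgroups `H` of `G` such that `1` has arbitrarily small `H`-invariant
neighbourhoods. These neighbourhoods can be taken compact and open
(`HasSmallInvariantNhds.exists_isCompact_isOpen`). The subgroup `N` has the property, it passes to
cyclic extensions because `⋂ k, g ^ k V g ^ (-k)` is open and invariant under both `H` and `g`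
(`HasSmallInvariantNhds.of_cyclic_extension`), and it passes from a subgroup of finite index to `G`
because only finitely many conjugates have to be intersected
(`HasSmallInvariantNhds.top_of_finiteIndex`).
-/

open Filter Set

/-! ### Recurrence of distal automorphisms -/

attribute [local instance] Ultrafilter.add Ultrafilter.addSemigroup in
theorem exists_idempotent_ultrafilter_pnat : ∃ p : Ultrafilter ℕ+, p + p = p :=
  exists_idempotent_of_compact_t2_of_continuous_add_left
    (@Ultrafilter.continuous_add_left ℕ+ _)

section Distal

variable {G : Type*} [Group G] [TopologicalSpace G]

theorem IsDistalAut.inv {α : MulAut G} (hα : IsDistalAut α) : IsDistalAut α⁻¹ := by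
  unfold IsDistalAut at *
  rwa [Subgroup.zpowers_inv]

theorem continuous_mulAut_pow {α : MulAut G} (hc : Continuous α) (n : ℕ) :
    Continuous (α ^ n : MulAut G) := by
  induction n with
  | zero => exact continuous_id
  | succ n ih => rw [pow_succ]; exact ih.comp hc

variable [IsTopologicalGroup G]

attribute [local instance] Ultrafilter.add in
/-- A point whose forward orbit under a distal automorphism stays in a compact set is recurrent:
it is the limit of its forward orbit along any idempotent ultrafilter, since it is proximal to that
limit. -/
theorem IsDistalAut.exists_pos_pow_apply_mem {α : MulAut G} (hα : IsDistalAut α)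
    (hc : Continuous α) {K : Set G} (hK : IsCompact K) {x : G} (hx : ∀ n : ℕ, (α ^ n) x ∈ K)
    {U : Set G} (hU : U ∈ 𝓝 x) : ∃ n : ℕ, 0 < n ∧ (α ^ n) x ∈ U := by
  obtain ⟨p, hp⟩ := exists_idempotent_ultrafilter_pnat
  obtain ⟨y, -, hy⟩ := hK.ultrafilter_le_nhds (p.map fun n : ℕ+ => (α ^ (n : ℕ)) x)
    (le_principal_iff.2 (Ultrafilter.mem_coe.2
      (Eventually.of_forall fun n : ℕ+ => hx n : ∀ᶠ n : ℕ+ in (p : Filter ℕ+), _)))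
  have hxy : Tendsto (fun n : ℕ+ => (α ^ (n : ℕ)) x) p (𝓝 y) := hy
  have hyy : Tendsto (fun n : ℕ+ => (α ^ (n : ℕ)) y) p (𝓝 y) := by
    refine (closed_nhds_basis y).tendsto_right_iff.2 fun C hC => ?_
    have h : ∀ᶠ k : ℕ+ in ((p + p : Ultrafilter ℕ+) : Filter ℕ+), (α ^ (k : ℕ)) x ∈ C := by
      rw [hp]; exact hxy hC.1
    rw [Ultrafilter.eventually_add] at h
    filter_upwards [h] with n hn
    refine hC.2.mem_of_tendsto (((continuous_mulAut_pow hc n).tendsto y).comp hxy) ?_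
    filter_upwards [hn] with m hm
    rwa [PNat.add_coe, pow_add] at hm
  have hxy1 : x⁻¹ * y = 1 := by
    by_contra hne
    refine hα _ hne (mem_closure_of_tendsto (f := fun n : ℕ+ => (α ^ (n : ℕ)) (x⁻¹ * y))
      (b := (p : Filter ℕ+)) ?_ ?_)
    · simpa using hxy.inv.mul hyy
    · exact Eventually.of_forall fun n : ℕ+ =>
        ⟨α ^ (n : ℕ), Subgroup.npow_mem_zpowers _ _, rfl⟩
  obtain rfl : x = y := inv_mul_eq_one.1 hxy1
  obtain ⟨n, hn⟩ := (hxy.eventually_mem hU).exists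
  exact ⟨n, n.pos, hn⟩

/-- If the forward orbit of a point under a distal automorphism stays in a compact set, then so does
its full orbit. -/
theorem IsDistalAut.zpow_apply_mem [T2Space G] {α : MulAut G} (hα : IsDistalAut α)
    (hc : Continuous α) (hc' : Continuous (α⁻¹ : MulAut G)) {K : Set G} (hK : IsCompact K) {x : G}
    (hx : ∀ n : ℕ, (α ^ n) x ∈ K) (k : ℤ) : (α ^ k) x ∈ K := by
  obtain ⟨n, rfl | rfl⟩ := k.eq_nat_or_neg
  · simpa using hx n
  by_contra hn
  -- If `x` returns to the neighbourhood `{z | α ^ (-n) z ∉ K}` of itself at time `m`, then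
  -- `α ^ (m - n) x ∉ K`: absurd for `n ≤ m`, and a smaller counterexample for `m < n`.
  induction n using Nat.strong_induction_on with
  | _ n ih =>
    have hcn : Continuous (α ^ (-(n : ℤ)) : MulAut G) := by
      rw [zpow_neg, zpow_natCast, ← inv_pow]
      exact continuous_mulAut_pow hc' n
    obtain ⟨m, hm, hmn⟩ := hα.exists_pos_pow_apply_mem hc hK hx
      ((hK.isClosed.isOpen_compl.preimage hcn).mem_nhds hn)
    have hmn' : (α ^ ((m : ℤ) - n)) x ∉ K := by
      have : (α ^ (-(n : ℤ))) ((α ^ m) x) = (α ^ ((m : ℤ) - n)) x := by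
        rw [← MulAut.mul_apply, ← zpow_natCast α m, ← zpow_add]
        congr 2; ring
      rw [← this]; exact hmn
    rcases le_or_gt n m with h | h
    · obtain ⟨l, rfl⟩ := Nat.exists_eq_add_of_le h
      refine hmn' ?_
      have := hx l
      rwa [← zpow_natCast, show (l : ℤ) = ((n + l : ℕ) : ℤ) - n by push_cast; ring] at this
    · refine ih (n - m) (by omega) ?_
      rwa [Nat.cast_sub h.le, neg_sub]

/-- For a distal automorphism `α` and a compact open set `V`, the largest `α`-invariant subset
`⋂ k : ℤ, α ^ k V` of `V` is open. -/
theorem isOpen_setOf_forall_zpow_apply_mem [T2Space G] {α : MulAut G} (hα : IsDistalAut α)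
    (hc : Continuous α) (hc' : Continuous (α⁻¹ : MulAut G)) {V : Set G} (hV : IsCompact V)
    (hVo : IsOpen V) : IsOpen {x : G | ∀ k : ℤ, (α ^ k) x ∈ V} := by
  -- It suffices that staying in `V` up to a fixed time `N` forces staying in `V` forever.
  suffices h : ∃ N : ℕ, ∀ x, (∀ i ≤ N, (α ^ i) x ∈ V) → (α ^ (N + 1)) x ∈ V by
    obtain ⟨N, hN⟩ := h
    have hfwd (x : G) (hx : ∀ i ≤ N, (α ^ i) x ∈ V) (n : ℕ) : (α ^ n) x ∈ V := by
      induction n using Nat.strong_induction_on with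
      | _ n ih =>
        rcases le_or_gt n N with h | h
        · exact hx n h
        · obtain ⟨l, rfl⟩ := Nat.exists_eq_add_of_lt h
          have := hN ((α ^ l) x) fun i hi => by
            rw [← MulAut.mul_apply, ← pow_add]
            exact ih _ (by omega)
          rw [← MulAut.mul_apply, ← pow_add] at this
          convert this using 3
          omega
    have : {x : G | ∀ k : ℤ, (α ^ k) x ∈ V} = ⋂ i ∈ Iic N, (α ^ i : MulAut G) ⁻¹' V := by
      ext x
      simp only [mem_ofPred_eq, mem_iInter, mem_Iic, mem_preimage]
      exact ⟨fun h i _ => by simpa using h i,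
        fun h => hα.zpow_apply_mem hc hc' hV (hfwd x h)⟩
    rw [this]
    exact (finite_Iic N).isOpen_biInter fun i _ => hVo.preimage (continuous_mulAut_pow hc i)
  by_contra! hcon
  choose x hx hx' using hcon
  -- `C n` consists of the last points in `V` of orbit segments of length `n` in `V`.
  let C : ℕ → Set G := fun n => {y | α y ∉ V ∧ ∀ i ≤ n, (α⁻¹ ^ i) y ∈ V}
  have hCc (n : ℕ) : IsClosed (C n) := by
    have : C n = (α ⁻¹' V)ᶜ ∩ ⋂ i ∈ Iic n, (α⁻¹ ^ i : MulAut G) ⁻¹' V := by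
      ext y; simp [C]
    rw [this]
    exact (hVo.preimage hc).isClosed_compl.inter
      (isClosed_biInter fun i _ => hV.isClosed.preimage (continuous_mulAut_pow hc' i))
  have hC0 : IsCompact (C 0) :=
    hV.of_isClosed_subset (hCc 0) fun y hy => by simpa using hy.2 0 le_rfl
  obtain ⟨y, hy⟩ := IsCompact.nonempty_iInter_of_sequence_nonempty_isCompact_isClosed C
    (fun n y hy => ⟨hy.1, fun i hi => hy.2 i (by omega)⟩)
    (fun n => ⟨(α ^ n) (x n), by
      rw [← MulAut.mul_apply, ← pow_succ']; exact hx' n, fun i hi => by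
      obtain ⟨l, rfl⟩ := Nat.exists_eq_add_of_le hi
      rw [← MulAut.mul_apply, pow_add, ← mul_assoc, inv_pow, inv_mul_cancel, one_mul]
      exact hx _ l (by omega)⟩) hC0 hCc
  rw [mem_iInter] at hy
  have := hα.inv.zpow_apply_mem hc' (by rwa [inv_inv]) hV (fun n => (hy n).2 n le_rfl) (-1)
  rw [zpow_neg_one, inv_inv] at this
  exact (hy 0).1 this

end Distal

/-! ### Small neighbourhoods invariant under a subgroup -/

/-- The identity of `G` has arbitrarily small neighbourhoods that are invariant under conjugation by
all elements of the subgroup `H`. -/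
def HasSmallInvariantNhds {G : Type*} [Group G] [TopologicalSpace G] (H : Subgroup G) : Prop :=
  ∀ U ∈ 𝓝 (1 : G), ∃ V ∈ 𝓝 (1 : G), V ⊆ U ∧ ∀ h ∈ H, ∀ x ∈ V, h * x * h⁻¹ ∈ V

theorem IsSIN.exists_invariant_nhd {G : Type*} [Group G] [TopologicalSpace G] (hG : IsSIN G)
    {U : Set G} (hU : U ∈ 𝓝 (1 : G)) :
    ∃ V ∈ 𝓝 (1 : G), V ⊆ U ∧ ∀ g, ∀ x ∈ V, g * x * g⁻¹ ∈ V := by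
  obtain ⟨V, ⟨hV, hinv⟩, hVU⟩ := hG.mem_iff.1 hU
  refine ⟨V, hV, hVU, fun g x hx => ?_⟩
  rw [← hinv (MulAut.conj g) ⟨g, rfl⟩]
  exact ⟨x, hx, rfl⟩

theorem IsSIN.isDistalGroup {G : Type*} [Group G] [TopologicalSpace G] [T1Space G]
    (hG : IsSIN G) : IsDistalGroup G := by
  intro x hx hcl
  obtain ⟨V, hV, hVx, hinv⟩ := hG.exists_invariant_nhd (isOpen_compl_singleton.mem_nhds hx.symm)
  obtain ⟨_, hy, _, ⟨g, rfl⟩, rfl⟩ := mem_closure_iff_nhds.1 hcl V hV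
  refine hVx ?_ (mem_singleton x)
  simpa [mul_assoc] using hinv g⁻¹ _ hy

theorem IsDistalGroup.isDistalElement {G : Type*} [Group G] [TopologicalSpace G]
    (hG : IsDistalGroup G) (g : G) : IsDistalElement g := by
  intro x hx hcl
  refine hG x hx (closure_mono ?_ hcl)
  rintro y ⟨γ, hγ, hy⟩
  exact ⟨γ, Subgroup.zpowers_le.2 (MonoidHom.mem_range.2 ⟨g, rfl⟩) hγ, hy⟩

namespace HasSmallInvariantNhds

variable {G : Type*} [Group G] [TopologicalSpace G]

theorem isSIN (h : HasSmallInvariantNhds (⊤ : Subgroup G)) : IsSIN G := by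
  refine ⟨fun t => ⟨fun ht => ?_, fun ⟨V, ⟨hV, _⟩, hVt⟩ => mem_of_superset hV hVt⟩⟩
  obtain ⟨V, hV, hVt, hinv⟩ := h t ht
  refine ⟨V, ⟨hV, ?_⟩, hVt⟩
  rintro _ ⟨g, rfl⟩
  refine Subset.antisymm ?_ fun x hx => ?_
  · rintro _ ⟨x, hx, rfl⟩
    exact hinv g trivial x hx
  · exact ⟨g⁻¹ * x * g, by simpa using hinv g⁻¹ trivial x hx, by simp [mul_assoc]⟩

theorem of_isSIN {N : Subgroup G} (hN : IsOpen (N : Set G)) (h : IsSIN N) :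
    HasSmallInvariantNhds N := by
  intro U hU
  obtain ⟨V, hV, hVU, hinv⟩ :=
    h.exists_invariant_nhd (continuous_subtype_val.continuousAt.preimage_mem_nhds (x := (1 : N)) hU)
  refine ⟨(↑) '' V, hN.isOpenEmbedding_subtypeVal.isOpenMap.image_mem_nhds hV,
    image_subset_iff.2 hVU, ?_⟩
  rintro n hn _ ⟨x, hx, rfl⟩
  exact ⟨_, hinv ⟨n, hn⟩ x hx, rfl⟩

variable [IsTopologicalGroup G]

/-- In a totally disconnected locally compact group, the small `H`-invariant neighbourhoods can be
taken compact and open. -/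
theorem exists_isCompact_isOpen [T2Space G] [LocallyCompactSpace G] [TotallyDisconnectedSpace G]
    {H : Subgroup G} (hH : HasSmallInvariantNhds H) {U : Set G} (hU : U ∈ 𝓝 (1 : G)) :
    ∃ V : Set G, IsCompact V ∧ IsOpen V ∧ (1 : G) ∈ V ∧ V ⊆ U ∧
      ∀ h ∈ H, ∀ x ∈ V, h * x * h⁻¹ ∈ V := by
  obtain ⟨L, hL, hLU, hLc⟩ := LocallyCompactSpace.local_compact_nhds (1 : G) U hU
  obtain ⟨K, hK, hK1, hKL⟩ := loc_compact_Haus_tot_disc_of_zero_dim.mem_nhds_iff.1 hL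
  have hKc : IsCompact K := hLc.of_isClosed_subset hK.isClosed hKL
  -- A neighbourhood `T` with `K * T ⊆ K`, once `H`-invariant, also satisfies `V * T ⊆ V` for the
  -- intersection `V` of all `H`-conjugates of `K`; hence `V` is open.
  obtain ⟨S, hS, hKS⟩ := compact_open_separated_mul_right hKc hK.isOpen Subset.rfl
  obtain ⟨T, hT, hTS, hTinv⟩ := hH S hS
  have hKT {a b : G} (ha : a ∈ K) (hb : b ∈ T) : a * b ∈ K := hKS (mul_mem_mul ha (hTS hb))
  have hsub : {x : G | ∀ h ∈ H, h * x * h⁻¹ ∈ K} ⊆ K := fun x hx => by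
    simpa using hx 1 H.one_mem
  refine ⟨{x | ∀ h ∈ H, h * x * h⁻¹ ∈ K}, hKc.of_isClosed_subset ?_ hsub, ?_, ?_,
    hsub.trans (hKL.trans hLU), ?_⟩
  · simp only [ofPred_forall]
    exact isClosed_biInter fun h _ => hK.isClosed.preimage (by fun_prop)
  · refine isOpen_iff_mem_nhds.2 fun x hx => ?_
    have hxT : (x⁻¹ * ·) ⁻¹' T ∈ 𝓝 x :=
      (continuous_const_mul x⁻¹).continuousAt.preimage_mem_nhds (by simpa using hT)
    filter_upwards [hxT] with y hy h hh
    have := hKT (hx h hh) (hTinv h hh _ hy)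
    simpa [mul_assoc] using this
  · intro h _
    simpa using hK1
  · intro h hh x hx k hk
    simpa [mul_assoc] using hx (k * h) (H.mul_mem hk hh)

/-- Small invariant neighbourhoods pass from `H` to a subgroup `H'` generated modulo `H` by one
distal element `g` normalizing `H`. -/
theorem of_cyclic_extension [T2Space G] [LocallyCompactSpace G] [TotallyDisconnectedSpace G]
    {H H' : Subgroup G} (hH : HasSmallInvariantNhds H) {g : G} (hg : IsDistalElement g)
    (hnorm : ∀ k : ℤ, ∀ h ∈ H, g ^ k * h * (g ^ k)⁻¹ ∈ H)
    (hgen : ∀ x ∈ H', ∃ k : ℤ, x * (g ^ k)⁻¹ ∈ H) : HasSmallInvariantNhds H' := by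
  intro U hU
  obtain ⟨V, hVc, hVo, hV1, hVU, hVinv⟩ := hH.exists_isCompact_isOpen hU
  have hopen := isOpen_setOf_forall_zpow_apply_mem hg (IsTopologicalGroup.continuous_conj g)
    (by rw [← map_inv]; exact IsTopologicalGroup.continuous_conj g⁻¹) hVc hVo
  simp only [← map_zpow, MulAut.conj_apply] at hopen
  refine ⟨_, hopen.mem_nhds (by simpa using hV1), fun x hx => hVU (by simpa using hx 0), ?_⟩
  intro a ha x hx k
  obtain ⟨l, hl⟩ := hgen a ha
  have := hVinv _ (hnorm k _ hl) _ (hx (k + l))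
  convert this using 1
  rw [zpow_add]
  group

theorem top_of_finiteIndex {H : Subgroup G} [H.FiniteIndex] (hH : HasSmallInvariantNhds H) :
    HasSmallInvariantNhds (⊤ : Subgroup G) := by
  intro U hU
  obtain ⟨V, hV, hVU, hVinv⟩ := hH U hU
  refine ⟨{x | ∀ g : G, g⁻¹ * x * g ∈ V}, ?_, fun x hx => hVU (by simpa using hx 1), ?_⟩
  -- The conjugate of `V` by `g` depends only on the coset `g H`.
  · have h (q : G ⧸ H) : ∀ᶠ x in 𝓝 (1 : G), q.out⁻¹ * x * q.out ∈ V := by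
      have : Continuous fun x : G => q.out⁻¹ * x * q.out := by fun_prop
      exact this.continuousAt.eventually_mem (by simpa using hV)
    filter_upwards [eventually_all.2 h] with x hx g
    obtain ⟨k, hk⟩ := QuotientGroup.mk_out_eq_mul H g
    have := hVinv k k.2 _ (hx g)
    rw [hk] at this
    simpa [mul_assoc] using this
  · intro h _ x hx g
    simpa [mul_assoc] using hx (h⁻¹ * g)

/-- Induction along the cyclic series of a polycyclic subgroup of `G ⧸ N`. -/
theorem of_isPolycyclic_quotient [T2Space G] [LocallyCompactSpace G] [TotallyDisconnectedSpace G]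
    {N : Subgroup G} [N.Normal] (hN : HasSmallInvariantNhds N) (hdist : ∀ g : G, IsDistalElement g)
    {P : Subgroup (G ⧸ N)} (hP : IsPolycyclic P) :
    HasSmallInvariantNhds (P.comap (QuotientGroup.mk' N)) := by
  obtain ⟨n, H, h0, hn, hstep⟩ := hP
  have key : ∀ i ≤ n,
      HasSmallInvariantNhds (((H i).map P.subtype).comap (QuotientGroup.mk' N)) := by
    intro i hi
    induction i with
    | zero => simpa [h0, MonoidHom.comap_bot] using hN
    | succ i ih =>
      obtain ⟨hle, hnormal, hcyc⟩ := hstep i hi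
      obtain ⟨q, hq⟩ := hcyc.exists_generator
      obtain ⟨c, rfl⟩ := QuotientGroup.mk_surjective q
      obtain ⟨g, hg⟩ := QuotientGroup.mk'_surjective N ((c : P) : G ⧸ N)
      refine (ih (by omega)).of_cyclic_extension (hdist g) ?_ ?_
      · rintro k h ⟨b, hb, hbh⟩
        refine ⟨((c ^ k * ⟨b, hle hb⟩ * (c ^ k)⁻¹ : H (i + 1)) : P),
          hnormal.conj_mem ⟨b, hle hb⟩ hb (c ^ k), ?_⟩
        rw [map_mul, map_mul, map_inv, map_zpow, hg, ← hbh]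
        simp
      · rintro x ⟨b, hb, hbx⟩
        obtain ⟨k, hk⟩ := hq ((⟨b, hb⟩ : H (i + 1)) : H (i + 1) ⧸ (H i).subgroupOf (H (i + 1)))
        refine ⟨k, ((⟨b, hb⟩ * (c ^ k)⁻¹ : H (i + 1)) : P), ?_, ?_⟩
        · have hk' : ((c ^ k : H (i + 1)) : H (i + 1) ⧸ (H i).subgroupOf (H (i + 1))) =
            ((⟨b, hb⟩ : H (i + 1)) : H (i + 1) ⧸ (H i).subgroupOf (H (i + 1))) := hk
          have := hnormal.mem_comm (QuotientGroup.eq.1 hk')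
          exact this
        · rw [map_mul, map_inv, map_zpow, hg, ← hbx]
          simp
  have := key n le_rfl
  rwa [hn, ← MonoidHom.range_eq_map, Subgroup.range_subtype] at this

end HasSmallInvariantNhds

theorem theorem2p7 {G : Type*} [Group G] [TopologicalSpace G] [IsTopologicalGroup G]
    [LocallyCompactSpace G] [TotallyDisconnectedSpace G] [TopologicalSpace.MetrizableSpace G]
    (N : Subgroup G) [N.Normal] (hN_open : IsOpen (N : Set G)) (hN_sin : IsSIN N)
    (hGN : IsVirtuallyPolycyclic (G ⧸ N)) :
    [IsDistalGroup G, ∀ g : G, IsDistalElement g, IsSIN G].TFAE := by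
  tfae_have 1 → 2 := fun h g => h.isDistalElement g
  tfae_have 3 → 1 := fun h => h.isDistalGroup
  tfae_have 2 → 3 := by
    intro hdist
    obtain ⟨P, hPfin, hP⟩ := hGN
    have hPG := (HasSmallInvariantNhds.of_isSIN hN_open hN_sin).of_isPolycyclic_quotient hdist hP
    have : (P.comap (QuotientGroup.mk' N)).FiniteIndex :=
      ⟨by rw [Subgroup.index_comap_of_surjective P (QuotientGroup.mk'_surjective N)]
          exact hPfin.index_ne_zero⟩
    exact hPG.top_of_finiteIndex.isSIN
  tfae_finish
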